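/- Let $a_1,a_2>0$. For every $u>0$ let $y(u)$ be the positive root of the cubic $$\frac{y^3}{3}+\frac{a_1+a_2}{2}\,y^2+a_1a_2\,y=\frac{u^2}{3},$$ and let $\phi$ be a function on $(0,\infty)$ with $u\,\phi'(u)=y(u)$; such $y$ and $\phi$ exist. For $k\ge 1$, let $\mathcal O(-k,-k)$ denote the total space of the line bundle $\mathcal O_{\mathbb P^1\times\mathbb P^1}(-k,-k)$. It is covered by four charts isomorphic to $\mathbb C^3$ with coordinates $(z_1,z_2,w)$; the transition maps are generated by $(z_1,z_2,w)\mapsto(1/z_1,z_2,z_1^kw)$ and $(z_1,z_2,w)\mapsto(z_1,1/z_2,z_2^kw)$. On $\mathcal O(-1,-1)$ put $u=|w|^2(1+|z_1|^2)(1+|z_2|^2)$, and off the zero section let $$\omega_{a_1,a_2}=\sqrt{-1}\,a_1\,\partial\bar\partial\log(1+|z_1|^2)+\sqrt{-1}\,a_2\,\partial\bar\partial\log(1+|z_2|^2)+\sqrt{-1}\,\partial\bar\partial\,\phi(u)$$ in each of the four charts; these local expressions define a global form there. Then there is a Kähler form $\hat\omega_{a_1,a_2}$ (a smooth closed positive real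 $(1,1)$-form) on the whole of $\mathcal O(-2,-2)$, zero section included, whose pullback under the $2:1$ map $\mathcal O(-1,-1)\to\mathcal O(-2,-2)$, $(z_1,z_2,w)\mapsto(z_1,z_2,v=w^2)$, equals $\omega_{a_1,a_2}$ off the zero section. Moreover $\hat\omega_{a_1,a_2}$ is Ricci-flat: writing $\hat\omega_{a_1,a_2}=\sqrt{-1}\sum_{a,b} h_{a\bar b}\,dz_a\wedge d\bar z_b$ in a chart, its Ricci form $-\sqrt{-1}\,\partial\bar\partial\log\det(h_{a\bar b})$ vanishes identically. -/

import Mathlib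

open scoped Manifold ContDiff Topology

/-! ## The total space of `𝒪(-k,-k)` over `ℙ¹ × ℙ¹` as a complex threefold -/

/-- The model space `ℂ³` of complex threefolds. -/
abbrev C3 : Type := Fin 3 → ℂ

/-- Triples `(p, q, t)` with `p, q ∈ ℂ² ∖ {0}` and `t ∈ ℂ`; such a triple stands for the vector
`t • (p^{⊗k} ⊗ q^{⊗k})` in the fibre of `𝒪(-k,-k)` over `([p], [q]) ∈ ℙ¹ × ℙ¹`. -/
abbrev PreTot : Type :=
  {P : (Fin 2 → ℂ) × (Fin 2 → ℂ) × ℂ // P.1 ≠ 0 ∧ P.2.1 ≠ 0}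

/-- `(p, q, t)` and `(l p, m q, l⁻ᵏ m⁻ᵏ t)` stand for the same vector of `𝒪(-k,-k)`. -/
def totSetoid (k : ℕ) : Setoid PreTot where
  r P Q := ∃ l m : ℂ, l ≠ 0 ∧ m ≠ 0 ∧ Q.1.1 = l • P.1.1 ∧ Q.1.2.1 = m • P.1.2.1 ∧
    P.1.2.2 = l ^ k * m ^ k * Q.1.2.2
  iseqv :=
    { refl := fun P => ⟨1, 1, one_ne_zero, one_ne_zero, by simp, by simp, by simp⟩
      symm := by
        rintro P Q ⟨l, m, hl, hm, h1, h2, h3⟩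
        refine ⟨l⁻¹, m⁻¹, inv_ne_zero hl, inv_ne_zero hm, ?_, ?_, ?_⟩
        · rw [h1, smul_smul, inv_mul_cancel₀ hl, one_smul]
        · rw [h2, smul_smul, inv_mul_cancel₀ hm, one_smul]
        · rw [h3, inv_pow, inv_pow]; field_simp
      trans := by
        rintro P Q R ⟨l, m, hl, hm, h1, h2, h3⟩ ⟨l', m', hl', hm', h1', h2', h3'⟩
        refine ⟨l' * l, m' * m, mul_ne_zero hl' hl, mul_ne_zero hm' hm, ?_, ?_, ?_⟩
        · rw [h1', h1, smul_smul]
        · rw [h2', h2, smul_smul]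
        · rw [h3, h3']; ring }

/-- The total space of the holomorphic line bundle `𝒪(-k,-k)` over `ℙ¹ × ℙ¹`. -/
def Tot (k : ℕ) : Type := Quotient (totSetoid k)

namespace Tot

variable {k : ℕ}

instance : TopologicalSpace (Tot k) :=
  inferInstanceAs (TopologicalSpace (Quotient (totSetoid k)))

/-- The point of `𝒪(-k,-k)` represented by a triple. -/
def mk (k : ℕ) (P : PreTot) : Tot k := Quotient.mk (totSetoid k) P

theorem isQuotientMap_mk (k : ℕ) : Topology.IsQuotientMap (mk k) := isQuotientMap_quotient_mk'

/-- The zero section. -/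
def zeroSection (k : ℕ) : Set (Tot k) :=
  {x | Quotient.liftOn x (fun P : PreTot => P.1.2.2 = 0) (by
    rintro P Q ⟨l, m, hl, hm, -, -, h3⟩
    simp [h3, hl, hm])}

/-- The `2 : 1` map `𝒪(-1,-1) → 𝒪(-2,-2)`, squaring the fibre coordinate. -/
def sq : Tot 1 → Tot 2 :=
  Quotient.map' (s₁ := totSetoid 1) (s₂ := totSetoid 2)
    (fun P => ⟨(P.1.1, P.1.2.1, P.1.2.2 ^ 2), P.2⟩) (by
      rintro P Q ⟨l, m, hl, hm, h1, h2, h3⟩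
      exact ⟨l, m, hl, hm, h1, h2, by simp only [h3]; ring⟩)

/-- The vector of `ℂ²` whose `i`-th entry is `1` and whose other entry is `z`. -/
def ins (i : Fin 2) (z : ℂ) : Fin 2 → ℂ := Function.update (fun _ => z) i 1

theorem ins_same (i : Fin 2) (z : ℂ) : ins i z i = 1 := by simp [ins]

theorem ins_other (i : Fin 2) (z : ℂ) : ins i z (i + 1) = z := by
  fin_cases i <;> simp [ins]

theorem ins_ne_zero (i : Fin 2) (z : ℂ) : ins i z ≠ 0 := fun h => by
  have := congrFun h i
  simp [ins_same] at this

theorem continuous_ins (i : Fin 2) : Continuous (ins i) := by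
  unfold ins; fun_prop

theorem eq_smul_ins (i : Fin 2) (p : Fin 2 → ℂ) (hp : p i ≠ 0) :
    p = p i • ins i (p (i + 1) / p i) := by
  ext a
  fin_cases i <;> fin_cases a <;> simp_all [ins] <;> field_simp

/-- The coordinates `(z₁, z₂, w)` on the open set `p i ≠ 0`, `q j ≠ 0`. -/
noncomputable def coordFun (k : ℕ) (i j : Fin 2) : Tot k → C3 := fun x =>
  Quotient.liftOn x (fun P : PreTot =>
    (![P.1.1 (i + 1) / P.1.1 i, P.1.2.1 (j + 1) / P.1.2.1 j,
      P.1.1 i ^ k * P.1.2.1 j ^ k * P.1.2.2] : C3)) (by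
    rintro P Q ⟨l, m, hl, hm, h1, h2, h3⟩
    simp only [h1, h2, h3, Pi.smul_apply, smul_eq_mul]
    rw [mul_div_mul_left _ _ hl, mul_div_mul_left _ _ hm]
    congr 3
    ring)

/-- The point with coordinates `(z₁, z₂, w)` in the chart `(i, j)`. -/
def param (k : ℕ) (i j : Fin 2) (c : C3) : Tot k :=
  mk k ⟨(ins i (c 0), ins j (c 1), c 2), ins_ne_zero _ _, ins_ne_zero _ _⟩

/-- The open set `p i ≠ 0`, `q j ≠ 0`. -/
def domain (k : ℕ) (i j : Fin 2) : Set (Tot k) :=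
  {x | Quotient.liftOn x (fun P : PreTot => P.1.1 i ≠ 0 ∧ P.1.2.1 j ≠ 0) (by
    rintro P Q ⟨l, m, hl, hm, h1, h2, -⟩
    simp [h1, h2, hl, hm])}

theorem isOpen_domain (k : ℕ) (i j : Fin 2) : IsOpen (domain k i j) := by
  rw [← (isQuotientMap_mk k).isOpen_preimage]
  have h : mk k ⁻¹' domain k i j = {P : PreTot | P.1.1 i ≠ 0} ∩ {P : PreTot | P.1.2.1 j ≠ 0} := rfl
  rw [h]
  exact (isOpen_ne_fun (by fun_prop) continuous_const).inter
    (isOpen_ne_fun (by fun_prop) continuous_const)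

theorem param_mem_domain (i j : Fin 2) (c : C3) : param k i j c ∈ domain k i j :=
  show ins i (c 0) i ≠ 0 ∧ ins j (c 1) j ≠ 0 by simp [ins_same]

theorem coordFun_param (i j : Fin 2) (c : C3) : coordFun k i j (param k i j c) = c := by
  change (![ins i (c 0) (i + 1) / ins i (c 0) i, ins j (c 1) (j + 1) / ins j (c 1) j,
      ins i (c 0) i ^ k * ins j (c 1) j ^ k * c 2] : C3) = c
  simp only [ins_same, ins_other]
  ext a
  fin_cases a <;> simp

theorem param_coordFun (i j : Fin 2) (x : Tot k) (hx : x ∈ domain k i j) :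
    param k i j (coordFun k i j x) = x := by
  induction x using Quotient.inductionOn with
  | h P =>
    obtain ⟨h1, h2⟩ : P.1.1 i ≠ 0 ∧ P.1.2.1 j ≠ 0 := hx
    exact Quotient.sound ⟨P.1.1 i, P.1.2.1 j, h1, h2, eq_smul_ins i _ h1, eq_smul_ins j _ h2, rfl⟩

/-- The four standard charts `(z₁, z₂, w)` of `𝒪(-k,-k)`. Chart `(0, 0)` has `z₁ = p 1 / p 0`,
`z₂ = q 1 / q 0`; passing to chart `(1, 0)` replaces `(z₁, z₂, w)` by `(1 / z₁, z₂, z₁ ^ k w)`,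
and so on. -/
noncomputable def chart (k : ℕ) (i j : Fin 2) : OpenPartialHomeomorph (Tot k) C3 where
  toFun := coordFun k i j
  invFun := param k i j
  source := domain k i j
  target := Set.univ
  map_source' _ _ := Set.mem_univ _
  map_target' c _ := param_mem_domain i j c
  left_inv' x hx := param_coordFun i j x hx
  right_inv' c _ := coordFun_param i j c
  open_source := isOpen_domain k i j
  open_target := isOpen_univ
  continuousOn_toFun := by
    rw [(isQuotientMap_mk k).continuousOn_isOpen_iff (isOpen_domain k i j)]
    have h : ∀ P ∈ mk k ⁻¹' domain k i j, P.1.1 i ≠ 0 ∧ P.1.2.1 j ≠ 0 := fun P hP => hP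
    refine continuousOn_pi.2 fun a => ?_
    change ContinuousOn (fun P : PreTot =>
      (![P.1.1 (i + 1) / P.1.1 i, P.1.2.1 (j + 1) / P.1.2.1 j,
        P.1.1 i ^ k * P.1.2.1 j ^ k * P.1.2.2] : C3) a) _
    fin_cases a
    · exact ContinuousOn.div (by fun_prop) (by fun_prop) fun P hP => (h P hP).1
    · exact ContinuousOn.div (by fun_prop) (by fun_prop) fun P hP => (h P hP).2
    · change ContinuousOn (fun P : PreTot => P.1.1 i ^ k * P.1.2.1 j ^ k * P.1.2.2) _
      fun_prop
  continuousOn_invFun := by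
    refine Continuous.continuousOn ((isQuotientMap_mk k).continuous.comp ?_)
    refine Continuous.subtype_mk ?_ _
    exact ((continuous_ins i).comp (continuous_apply 0)).prodMk
      (((continuous_ins j).comp (continuous_apply 1)).prodMk (continuous_apply 2))

theorem exists_mem_domain (x : Tot k) : ∃ ij : Fin 2 × Fin 2, x ∈ domain k ij.1 ij.2 := by
  induction x using Quotient.inductionOn with
  | h P =>
    obtain ⟨i, hi⟩ := Function.ne_iff.1 P.2.1
    obtain ⟨j, hj⟩ := Function.ne_iff.1 P.2.2
    exact ⟨(i, j), hi, hj⟩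

noncomputable instance : ChartedSpace C3 (Tot k) where
  atlas := Set.range fun ij : Fin 2 × Fin 2 => chart k ij.1 ij.2
  chartAt x := chart k (exists_mem_domain x).choose.1 (exists_mem_domain x).choose.2
  mem_chart_source x := (exists_mem_domain x).choose_spec
  chart_mem_atlas _ := Set.mem_range_self _

theorem contDiffOn_transition (i j i' j' : Fin 2) :
    ContDiffOn ℂ ω (fun c => coordFun k i' j' (param k i j c))
      {c | param k i j c ∈ domain k i' j'} := by
  have hins : ∀ (i a : Fin 2) (b : Fin 3), ContDiff ℂ ω fun c : C3 => ins i (c b) a := by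
    intro i a b
    unfold ins
    fin_cases i <;> fin_cases a <;> simp [Function.update] <;> fun_prop
  have h : ∀ c ∈ {c | param k i j c ∈ domain k i' j'},
      ins i (c 0) i' ≠ 0 ∧ ins j (c 1) j' ≠ 0 := fun c hc => hc
  refine contDiffOn_pi.2 fun a => ?_
  change ContDiffOn ℂ ω (fun c : C3 =>
    (![ins i (c 0) (i' + 1) / ins i (c 0) i', ins j (c 1) (j' + 1) / ins j (c 1) j',
      ins i (c 0) i' ^ k * ins j (c 1) j' ^ k * c 2] : C3) a) _
  fin_cases a
  · exact (hins _ _ _).contDiffOn.div (hins _ _ _).contDiffOn fun c hc => (h c hc).1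
  · exact (hins _ _ _).contDiffOn.div (hins _ _ _).contDiffOn fun c hc => (h c hc).2
  · exact ((((hins _ _ _).pow k).mul ((hins _ _ _).pow k)).mul (by fun_prop)).contDiffOn

/-- `𝒪(-k,-k)` is a complex manifold. -/
instance : IsManifold 𝓘(ℂ, C3) ω (Tot k) := by
  refine isManifold_of_contDiffOn _ _ _ ?_
  rintro _ _ ⟨⟨i, j⟩, rfl⟩ ⟨⟨i', j'⟩, rfl⟩
  refine (contDiffOn_transition (k := k) i j i' j').mono ?_
  rintro c ⟨⟨-, hc⟩, -⟩
  exact hc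

/-- The underlying real manifold of `𝒪(-k,-k)`. -/
instance : IsManifold 𝓘(ℝ, C3) ω (Tot k) := by
  refine isManifold_of_contDiffOn _ _ _ ?_
  rintro _ _ ⟨⟨i, j⟩, rfl⟩ ⟨⟨i', j'⟩, rfl⟩
  refine ((contDiffOn_transition (k := k) i j i' j').restrict_scalars ℝ).mono ?_
  rintro c ⟨⟨-, hc⟩, -⟩
  exact hc

end Tot

/-! ## Forms on open subsets of `ℂ³` -/

/-- Multiplication by `√-1` on `ℂ³`, as a real linear map. -/
noncomputable def mulI : C3 →L[ℝ] C3 :=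
  ((Complex.I • ContinuousLinearMap.id ℂ C3 : C3 →L[ℂ] C3)).restrictScalars ℝ

/-- `dᶜ f = √-1 (∂̄ - ∂) f`, that is, `(dᶜ f)(v) = - df(√-1 v)`. -/
noncomputable def dc (f : C3 → ℝ) (c : C3) : C3 [⋀^Fin 1]→L[ℝ] ℝ :=
  ContinuousAlternatingMap.ofSubsingleton ℝ C3 ℝ (0 : Fin 1) (-(fderiv ℝ f c).comp mulI)

/-- The real two-form `√-1 ∂∂̄ f = ½ d dᶜ f`. -/
noncomputable def iddbar (f : C3 → ℝ) (c : C3) : C3 [⋀^Fin 2]→L[ℝ] ℝ :=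
  (1 / 2 : ℝ) • extDeriv (dc f) c

/-- The coefficients `h a b` of a real `(1,1)`-form
`√-1 ∑ h a b dz_a ∧ dz̄_b` on `ℂ³`. -/
noncomputable def coeffMatrix (η : C3 [⋀^Fin 2]→L[ℝ] ℝ) : Matrix (Fin 3) (Fin 3) ℂ :=
  fun a b =>
    ((η ![Pi.single a 1, mulI (Pi.single b 1)] : ℂ) -
      Complex.I * (η ![Pi.single a 1, Pi.single b 1] : ℂ)) / 2

/-! ## Kähler forms on complex threefolds -/

section Kahler

variable {X : Type*} [TopologicalSpace X] [ChartedSpace C3 X]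
variable {Y : Type*} [TopologicalSpace Y] [ChartedSpace C3 Y]

/-- A field of real alternating two-forms on the real tangent spaces of `X`
(no regularity is assumed). -/
abbrev TwoForm (X : Type*) [TopologicalSpace X] [ChartedSpace C3 X] : Type _ :=
  (x : X) → TangentSpace 𝓘(ℝ, C3) x [⋀^Fin 2]→L[ℝ] ℝ

/-- The complex structure on the tangent space at `x`. -/
noncomputable def tangentJ (x : X) : TangentSpace 𝓘(ℝ, C3) x →L[ℝ] TangentSpace 𝓘(ℝ, C3) x :=
  mulI

namespace TwoForm

/-- Pullback along a map of manifolds. -/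
noncomputable def pullback (F : X → Y) (η : TwoForm Y) : TwoForm X := fun x =>
  (η (F x)).compContinuousLinearMap (mfderiv 𝓘(ℝ, C3) 𝓘(ℝ, C3) F x)

/-- The expression of a two-form in the coordinates given by the chart `e`. -/
noncomputable def inChart (η : TwoForm X) (e : OpenPartialHomeomorph X C3) (c : C3) :
    C3 [⋀^Fin 2]→L[ℝ] ℝ :=
  (η (e.symm c)).compContinuousLinearMap (mfderiv 𝓘(ℝ, C3) 𝓘(ℝ, C3) e.symm c)

/-- `η` is a Kähler form: a smooth closed positive real `(1,1)`-form. -/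
structure IsKahler (η : TwoForm X) : Prop where
  smooth : ∀ e ∈ atlas C3 X, ContDiffOn ℝ ∞ (η.inChart e) e.target
  closed : ∀ e ∈ atlas C3 X, ∀ c ∈ e.target, extDeriv (η.inChart e) c = 0
  typeOneOne : ∀ (x : X) (v w : TangentSpace 𝓘(ℝ, C3) x),
    η x ![tangentJ x v, tangentJ x w] = η x ![v, w]
  positive : ∀ (x : X) (v : TangentSpace 𝓘(ℝ, C3) x), v ≠ 0 → 0 < η x ![v, tangentJ x v]

/-- The Ricci form `ρ = -√-1 ∂∂̄ log det (h a b)` in the chart `e`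
of the Kähler metric with Kähler form `η = √-1 ∑ h a b dz_a ∧ dz̄_b`. -/
noncomputable def ricciForm (η : TwoForm X) (e : OpenPartialHomeomorph X C3) (c : C3) :
    C3 [⋀^Fin 2]→L[ℝ] ℝ :=
  -iddbar (fun c' => Real.log (coeffMatrix (η.inChart e c')).det.re) c

/-- The Ricci form vanishes identically. -/
def IsRicciFlat (η : TwoForm X) : Prop :=
  ∀ e ∈ atlas C3 X, ∀ c ∈ e.target, η.ricciForm e c = 0

end TwoForm

end Kahler

/-! ## The Calabi ansatz on `𝒪(-1,-1)` -/

/-- The squared norm `u = |w|² (1 + |z₁|²) (1 + |z₂|²)` in any of the four standard charts. -/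
noncomputable def normU (c : C3) : ℝ :=
  ‖c 2‖ ^ 2 * (1 + ‖c 0‖ ^ 2) * (1 + ‖c 1‖ ^ 2)

/-- Off the zero section of `𝒪(-1,-1)`, `η` is the form
`a₁ π₁^* ω_{ℙ¹} + a₂ π₂^* ω_{ℙ¹} + √-1 ∂∂̄ φ(u)`, where `ω_{ℙ¹} = √-1 ∂∂̄ log (1 + |z|²)`. -/
def IsCalabiForm (a₁ a₂ : ℝ) (φ : ℝ → ℝ) (η : TwoForm (Tot 1)) : Prop :=
  ∀ (i j : Fin 2) (c : C3), c 2 ≠ 0 →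
    η.inChart (Tot.chart 1 i j) c =
      a₁ • iddbar (fun c' => Real.log (1 + ‖c' 0‖ ^ 2)) c +
      a₂ • iddbar (fun c' => Real.log (1 + ‖c' 1‖ ^ 2)) c +
      iddbar (fun c' => φ (normU c')) c

/-- For `u > 0`, `y(u)` is the positive root of the cubic
`y³/3 + (a₁ + a₂) y²/2 + a₁ a₂ y = u²/3`, and `φ` is a function of `u` with `u φ'(u) = y(u)`. -/
def IsCalabiProfile (a₁ a₂ : ℝ) (y φ : ℝ → ℝ) : Prop :=
  ∀ u : ℝ, 0 < u →
    (0 < y u ∧ y u ^ 3 / 3 + (a₁ + a₂) / 2 * y u ^ 2 + a₁ * a₂ * y u = u ^ 2 / 3) ∧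
    HasDerivAt φ (y u / u) u

/-! ## Calculus of `√-1 ∂∂̄` -/

/-! The natural variable is U = u², which on 𝒪(-2,-2) is the squared norm `normV` and is smooth
across the zero section. Put φ(u) = Φ(u²). Then u φ'(u) = 2 U Φ'(U) = Y(U), where Y inverts the
cubic y³ + (3/2)(a₁ + a₂) y² + 3 a₁a₂ y. The cubic has derivative 3 (y + a₁)(y + a₂), nonzero at y =
0, so Y is smooth at U = 0 (`exists_momentum`). As the cubic is y D(y) with D(0) ≠ 0, Φ' = 1 / (2
D(Y)) is smooth there too (`exists_isMomentumPotential`). This is why the form extends over the zero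
section.

In a chart, completing the square in the complex Hessian of the potential (`hasLevi_normV`,
`hasLevi_calabiPotential`) diagonalises it in a coframe dz₁, dz₂, dv + t₁dz₁ + t₂dz₂. The weights
are (Y + aᵢ) / (1 + |zᵢ|²)² and (1 + |z₁|²)² (1 + |z₂|²)² (Φ' + U Φ''). All are positive, and Φ' + U
Φ'' = Y'/2 = 1 / (6 (Y + a₁)(Y + a₂)), so everything cancels in the determinant, which is 1/6.
Positivity and Ricci-flatness follow.

Under a change of chart the potential changes by multiples of log |z|², which are pluriharmonic, so
the local forms glue (`iddbar_calabiPotential_transition`). Finally φ is determined up to an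
additive constant (`IsCalabiProfile.exists_eq_add`), which Φ absorbs. -/

theorem mulI_apply (v : C3) : mulI v = Complex.I • v := rfl

theorem mulI_mulI (v : C3) : mulI (mulI v) = -v := by
  simp [mulI_apply, smul_smul]

/-- The operator sending `d f` to `dᶜ f`, as a continuous linear map. -/
noncomputable def dcCLM : (C3 →L[ℝ] ℝ) →L[ℝ] C3 [⋀^Fin 1]→L[ℝ] ℝ :=
  ((ContinuousAlternatingMap.ofSubsingletonLIE (0 : Fin 1) :
      (C3 →L[ℝ] ℝ) ≃ₗᵢ[ℝ] C3 [⋀^Fin 1]→L[ℝ] ℝ) : (C3 →L[ℝ] ℝ) →L[ℝ] C3 [⋀^Fin 1]→L[ℝ] ℝ).comp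
    (-((ContinuousLinearMap.compL ℝ C3 C3 ℝ).flip mulI))

theorem dcCLM_apply (l : C3 →L[ℝ] ℝ) (v : Fin 1 → C3) : dcCLM l v = -l (mulI (v 0)) := rfl

theorem dc_eq (f : C3 → ℝ) : dc f = fun c => dcCLM (fderiv ℝ f c) := rfl

theorem ContDiffAt.differentiableAt_fderiv {f : C3 → ℝ} {c : C3} (hf : ContDiffAt ℝ 2 f c) :
    DifferentiableAt ℝ (fderiv ℝ f) c :=
  (hf.fderiv_right (m := 1) (by norm_num)).differentiableAt one_ne_zero

theorem ContDiffAt.differentiableAt_dc {f : C3 → ℝ} {c : C3} (hf : ContDiffAt ℝ 2 f c) :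
    DifferentiableAt ℝ (dc f) c :=
  dcCLM.differentiableAt.comp c hf.differentiableAt_fderiv

theorem iddbar_apply {f : C3 → ℝ} {c : C3} (hf : ContDiffAt ℝ 2 f c) (v : Fin 2 → C3) :
    iddbar f c v = (fderiv ℝ (fderiv ℝ f) c (v 1) (mulI (v 0)) -
      fderiv ℝ (fderiv ℝ f) c (v 0) (mulI (v 1))) / 2 := by
  have h : fderiv ℝ (dc f) c = dcCLM.comp (fderiv ℝ (fderiv ℝ f) c) :=
    (dcCLM.hasFDerivAt.comp c hf.differentiableAt_fderiv.hasFDerivAt).fderiv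
  rw [iddbar, extDeriv, h]
  simp only [ContinuousAlternatingMap.smul_apply,
    ContinuousAlternatingMap.alternatizeUncurryFin_apply]
  simp [dcCLM_apply, Fin.removeNth]
  ring

theorem iddbar_add {f g : C3 → ℝ} {c : C3} (hf : ContDiffAt ℝ 2 f c) (hg : ContDiffAt ℝ 2 g c) :
    iddbar (fun x => f x + g x) c = iddbar f c + iddbar g c := by
  have h : dc (fun x => f x + g x) =ᶠ[𝓝 c] fun x => dc f x + dc g x := by
    filter_upwards [hf.eventually (by simp), hg.eventually (by simp)] with x h1 h2
    simp only [dc_eq]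
    rw [fderiv_fun_add (h1.differentiableAt two_ne_zero) (h2.differentiableAt two_ne_zero), map_add]
  rw [iddbar, h.extDeriv_eq, extDeriv_fun_add hf.differentiableAt_dc hg.differentiableAt_dc,
    smul_add]
  rfl

theorem iddbar_const_smul (a : ℝ) (f : C3 → ℝ) (c : C3) :
    iddbar (fun x => a * f x) c = a • iddbar f c := by
  have h : dc (fun x => a * f x) = a • dc f := by
    ext1 x
    simp only [dc_eq, Pi.smul_apply, ← map_smul]
    congr 1
    -- Over a field, constants pass through `fderiv` even where `f` is not differentiable, so no
    -- regularity is needed.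
    exact congrFun (fderiv_const_smul_field (𝕜 := ℝ) (R := ℝ) (f := f) a) x
  rw [iddbar, h, extDeriv_smul, smul_comm]
  rfl

theorem iddbar_const (a : ℝ) (c : C3) : iddbar (fun _ => a) c = 0 := by
  ext v
  simp [iddbar_apply contDiffAt_const]

theorem Filter.EventuallyEq.iddbar_eq {f g : C3 → ℝ} {c : C3} (h : f =ᶠ[𝓝 c] g) :
    iddbar f c = iddbar g c := by
  have : dc f =ᶠ[𝓝 c] dc g := by
    filter_upwards [h.fderiv (𝕜 := ℝ)] with x hx
    simp only [dc_eq, hx]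
  rw [iddbar, iddbar, this.extDeriv_eq]

theorem ContDiff.dc {f : C3 → ℝ} (hf : ContDiff ℝ ∞ f) : ContDiff ℝ ∞ (dc f) :=
  dcCLM.contDiff.comp (hf.fderiv_right (by rfl))

theorem ContDiff.iddbar {f : C3 → ℝ} (hf : ContDiff ℝ ∞ f) : ContDiff ℝ ∞ (iddbar f) := by
  have h : _root_.iddbar f = fun c => (1 / 2 : ℝ) •
      ContinuousAlternatingMap.alternatizeUncurryFinCLM ℝ C3 ℝ (fderiv ℝ (_root_.dc f) c) := by
    ext1 c
    rfl
  rw [h]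
  exact ((ContinuousLinearMap.contDiff _).comp (hf.dc.fderiv_right (by rfl))).const_smul _

theorem extDeriv_iddbar {f : C3 → ℝ} (hf : ContDiff ℝ ∞ f) (c : C3) :
    extDeriv (iddbar f) c = 0 := by
  have h : iddbar f = (1 / 2 : ℝ) • extDeriv (dc f) := rfl
  have h2 : minSmoothness ℝ 2 ≤ (∞ : ℕ∞ω) := by
    rw [minSmoothness_of_isRCLikeNormedField]
    exact ENat.LEInfty.out
  rw [h, extDeriv_smul, extDeriv_extDeriv hf.dc h2]
  simp

theorem ContDiffAt.fderiv_fderiv_comm {f : C3 → ℝ} {c : C3} (hf : ContDiffAt ℝ 2 f c) (v w : C3) :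
    fderiv ℝ (fderiv ℝ f) c v w = fderiv ℝ (fderiv ℝ f) c w v :=
  hf.isSymmSndFDerivAt (by rw [minSmoothness_of_isRCLikeNormedField]) v w

theorem iddbar_mulI_mulI {f : C3 → ℝ} {c : C3} (hf : ContDiffAt ℝ 2 f c) (v w : C3) :
    iddbar f c ![mulI v, mulI w] = iddbar f c ![v, w] := by
  simp only [iddbar_apply hf, Matrix.cons_val_zero, Matrix.cons_val_one, mulI_mulI, map_neg]
  rw [hf.fderiv_fderiv_comm (mulI w), hf.fderiv_fderiv_comm (mulI v)]
  ring

/-- `√-1 ∂∂̄` commutes with pullback along holomorphic maps. -/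
theorem iddbar_comp {f : C3 → ℝ} {T : C3 → C3} {c : C3} (hf : ContDiffAt ℝ 2 f (T c))
    (hT : ContDiffAt ℂ ω T c) :
    iddbar (fun x => f (T x)) c =
      (iddbar f (T c)).compContinuousLinearMap (fderiv ℝ T c) := by
  have hT1 : ContDiffAt ℝ ω T c := hT.restrict_scalars ℝ
  have h : dc (fun x => f (T x)) =ᶠ[𝓝 c]
      fun x => (dc f (T x)).compContinuousLinearMap (fderiv ℝ T x) := by
    filter_upwards [hT.eventually (by simp),
      hT.continuousAt.eventually (hf.eventually (by simp))] with x h1 h2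
    have h1' : DifferentiableAt ℂ T x := h1.differentiableAt (by simp)
    have h3 : fderiv ℝ (fun x => f (T x)) x = (fderiv ℝ f (T x)).comp (fderiv ℝ T x) :=
      fderiv_comp x (h2.differentiableAt two_ne_zero) (h1'.restrictScalars ℝ)
    ext v
    simp only [dc_eq, h3, dcCLM_apply, ContinuousAlternatingMap.compContinuousLinearMap_apply,
      Function.comp_apply, ContinuousLinearMap.comp_apply]
    -- Holomorphy enters here: the real derivative of `T` is complex linear, hence commutes with
    -- `mulI`.
    rw [h1'.fderiv_restrictScalars ℝ]
    simp [mulI_apply]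
  rw [iddbar, h.extDeriv_eq, extDeriv_pullback hf.differentiableAt_dc hT1
    (by rw [minSmoothness_of_isRCLikeNormedField]; exact le_top)]
  rfl

/-! ## Levi forms -/

/-- `∂ f = α` and `∂∂̄ f = β` at the point `c`, with `α` complex linear and `β v w` the value of
the sesquilinear form `∑ ∂_a ∂̄_b f v_a conj (w_b)`. -/
structure HasLevi (f : C3 → ℝ) (c : C3) (α : C3 → ℂ) (β : C3 → C3 → ℂ) : Prop where
  contDiffAt : ContDiffAt ℝ 2 f c
  fderiv_eq : ∀ v, fderiv ℝ f c v = 2 * (α v).re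
  map_mulI : ∀ v, α (mulI v) = Complex.I * α v
  levi_eq : ∀ v w, fderiv ℝ (fderiv ℝ f) c v w + fderiv ℝ (fderiv ℝ f) c (mulI v) (mulI w) =
    4 * (β v w).re

namespace HasLevi

variable {f g : C3 → ℝ} {c : C3} {α γ : C3 → ℂ} {β δ : C3 → C3 → ℂ}

theorem const (a : ℝ) (c : C3) : HasLevi (fun _ => a) c (fun _ => 0) (fun _ _ => 0) where
  contDiffAt := contDiffAt_const
  fderiv_eq := by simp
  map_mulI := by simp
  levi_eq := by simp

theorem add (hf : HasLevi f c α β) (hg : HasLevi g c γ δ) :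
    HasLevi (fun x => f x + g x) c (fun v => α v + γ v) (fun v w => β v w + δ v w) where
  contDiffAt := hf.contDiffAt.add hg.contDiffAt
  fderiv_eq v := by
    rw [fderiv_fun_add (hf.contDiffAt.differentiableAt two_ne_zero)
      (hg.contDiffAt.differentiableAt two_ne_zero), add_apply, hf.fderiv_eq, hg.fderiv_eq,
      Complex.add_re]
    ring
  map_mulI v := by rw [hf.map_mulI, hg.map_mulI]; ring
  levi_eq v w := by
    have h : fderiv ℝ (fun x => f x + g x) =ᶠ[𝓝 c] fun x => fderiv ℝ f x + fderiv ℝ g x := by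
      filter_upwards [hf.contDiffAt.eventually (by simp), hg.contDiffAt.eventually (by simp)]
        with x h1 h2
      exact fderiv_fun_add (h1.differentiableAt two_ne_zero) (h2.differentiableAt two_ne_zero)
    rw [h.fderiv_eq, fderiv_fun_add hf.contDiffAt.differentiableAt_fderiv
      hg.contDiffAt.differentiableAt_fderiv]
    have h1 := hf.levi_eq v w
    have h2 := hg.levi_eq v w
    simp only [add_apply, Complex.add_re]
    linarith

/-- Leibniz rule with cross terms ∂f ⊗ ∂̄g + ∂g ⊗ ∂̄f. Such closure rules reduce the complex Hessian
of the explicit potential to algebra. -/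
theorem mul (hf : HasLevi f c α β) (hg : HasLevi g c γ δ) :
    HasLevi (fun x => f x * g x) c (fun v => f c * γ v + g c * α v)
      (fun v w => f c * δ v w + g c * β v w + α v * star (γ w) + γ v * star (α w)) where
  contDiffAt := hf.contDiffAt.mul hg.contDiffAt
  fderiv_eq v := by
    rw [fderiv_fun_mul (hf.contDiffAt.differentiableAt two_ne_zero)
      (hg.contDiffAt.differentiableAt two_ne_zero)]
    simp only [add_apply, smul_apply, hf.fderiv_eq, hg.fderiv_eq, smul_eq_mul, Complex.add_re,
      Complex.re_ofReal_mul]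
    ring
  map_mulI v := by rw [hf.map_mulI, hg.map_mulI]; ring
  levi_eq v w := by
    have h : fderiv ℝ (fun x => f x * g x) =ᶠ[𝓝 c]
        fun x => f x • fderiv ℝ g x + g x • fderiv ℝ f x := by
      filter_upwards [hf.contDiffAt.eventually (by simp), hg.contDiffAt.eventually (by simp)]
        with x h1 h2
      exact fderiv_fun_mul (h1.differentiableAt two_ne_zero) (h2.differentiableAt two_ne_zero)
    have hf1 := hf.contDiffAt.differentiableAt two_ne_zero
    have hg1 := hg.contDiffAt.differentiableAt two_ne_zero
    have hf2 := hf.contDiffAt.differentiableAt_fderiv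
    have hg2 := hg.contDiffAt.differentiableAt_fderiv
    rw [h.fderiv_eq, fderiv_fun_add (hf1.fun_smul hg2) (hg1.fun_smul hf2), fderiv_fun_smul hf1 hg2,
      fderiv_fun_smul hg1 hf2]
    have h1 := hf.levi_eq v w
    have h2 := hg.levi_eq v w
    simp only [add_apply, smul_apply, ContinuousLinearMap.smulRight_apply, hf.fderiv_eq,
      hg.fderiv_eq, hf.map_mulI, hg.map_mulI, smul_eq_mul, Complex.add_re, Complex.mul_re, Complex.I_re, Complex.I_im, Complex.star_def,
      Complex.conj_re, Complex.conj_im, Complex.ofReal_re, Complex.ofReal_im]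
    linear_combination f c * h2 + g c * h1

/-- Regularity of `φ` is asked only at the value `f c`, since Φ is controlled only on `[0, ∞)`. -/
theorem comp {φ : ℝ → ℝ} (hφ : ContDiffAt ℝ 2 φ (f c)) (hf : HasLevi f c α β) :
    HasLevi (fun x => φ (f x)) c (fun v => deriv φ (f c) * α v)
      (fun v w => deriv φ (f c) * β v w + deriv (deriv φ) (f c) * (α v * star (α w))) where
  contDiffAt := hφ.comp c hf.contDiffAt
  fderiv_eq v := by
    have h := (hφ.differentiableAt two_ne_zero).hasDerivAt.comp_hasFDerivAt c
      (hf.contDiffAt.differentiableAt two_ne_zero).hasFDerivAt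
    have h' : fderiv ℝ (fun x => φ (f x)) c = _ := h.fderiv
    rw [h']
    simp only [smul_apply, hf.fderiv_eq, smul_eq_mul, Complex.re_ofReal_mul]
    ring
  map_mulI v := by rw [hf.map_mulI]; ring
  levi_eq v w := by
    have h : fderiv ℝ (fun x => φ (f x)) =ᶠ[𝓝 c] fun x => deriv φ (f x) • fderiv ℝ f x := by
      filter_upwards [hf.contDiffAt.eventually (by simp),
        hf.contDiffAt.continuousAt.eventually (hφ.eventually (by simp))] with x h1 h2
      exact ((h2.differentiableAt two_ne_zero).hasDerivAt.comp_hasFDerivAt x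
        (h1.differentiableAt two_ne_zero).hasFDerivAt).fderiv
    have hf1 := hf.contDiffAt.differentiableAt two_ne_zero
    have hf2 := hf.contDiffAt.differentiableAt_fderiv
    have hφ2 : DifferentiableAt ℝ (deriv φ) (f c) := by
      have := (hφ.fderiv_right (m := 1) (by norm_num)).differentiableAt one_ne_zero
      exact this.clm_apply (differentiableAt_const _)
    have h3 : HasFDerivAt (fun x => deriv φ (f x)) _ c :=
      hφ2.hasDerivAt.comp_hasFDerivAt c hf1.hasFDerivAt
    rw [h.fderiv_eq, (h3.fun_smul hf2.hasFDerivAt).fderiv]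
    have h1 := hf.levi_eq v w
    simp only [add_apply, smul_apply, ContinuousLinearMap.smulRight_apply,
      hf.fderiv_eq, hf.map_mulI, smul_eq_mul, Complex.add_re, Complex.mul_im, Complex.mul_re, Complex.I_re, Complex.I_im, Complex.star_def,
      Complex.conj_re, Complex.conj_im, Complex.ofReal_re, Complex.ofReal_im]
    linear_combination deriv φ (f c) * h1

theorem normSq_apply (b : Fin 3) (c : C3) :
    HasLevi (fun x => ‖x b‖ ^ 2) c (fun v => star (c b) * v b) (fun v w => v b * star (w b)) := by
  -- The differential of a quadratic form is linear in the base point; exhibited as a continuous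
  -- linear map, it is its own derivative.
  have h1 : fderiv ℝ (fun x : C3 => ‖x b‖ ^ 2) =
      fun x => (2 • ((ContinuousLinearMap.compL ℝ C3 ℂ ℝ).flip
        (ContinuousLinearMap.proj b)).comp ((innerSL ℝ).comp
          (ContinuousLinearMap.proj (R := ℝ) (φ := fun _ : Fin 3 => ℂ) b))) x := by
    ext1 x
    exact ((ContinuousLinearMap.proj (R := ℝ) (φ := fun _ : Fin 3 => ℂ) b).hasFDerivAt
      (x := x)).norm_sq.fderiv
  refine ⟨?_, fun v => ?_, fun v => ?_, fun v w => ?_⟩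
  · exact (ContDiff.norm_sq ℝ (by fun_prop)).contDiffAt
  · rw [h1]
    simp [Complex.inner]
    ring
  · simp [mulI_apply]
    ring
  · rw [h1, ContinuousLinearMap.fderiv]
    simp [Complex.inner, mulI_apply]
    ring

theorem iddbar_eq (hf : HasLevi f c α β) (v w : C3) :
    iddbar f c ![v, mulI w] = 2 * (β v w).re := by
  have h := hf.levi_eq v w
  rw [iddbar_apply hf.contDiffAt]
  simp only [Matrix.cons_val_zero, Matrix.cons_val_one, mulI_mulI, map_neg]
  rw [hf.contDiffAt.fderiv_fderiv_comm (mulI w)]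
  linarith

/-- `HasLevi` does not record that `β` is conjugate linear, so the value is obtained by writing `w`
as `-mulI (mulI w)`. -/
theorem iddbar_eq_neg (hf : HasLevi f c α β) (v w : C3) :
    iddbar f c ![v, w] = -2 * (β v (mulI w)).re := by
  have h : w = -mulI (mulI w) := by rw [mulI_mulI, neg_neg]
  have h1 := hf.levi_eq v (mulI w)
  rw [iddbar_apply hf.contDiffAt]
  simp only [Matrix.cons_val_zero, Matrix.cons_val_one]
  rw [hf.contDiffAt.fderiv_fderiv_comm w]
  rw [mulI_mulI, map_neg] at h1
  linarith

end HasLevi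

/-! ## The momentum profile -/

/-- Three times the cubic of the momentum profile. -/
noncomputable def momentumCubic (a₁ a₂ y : ℝ) : ℝ :=
  y ^ 3 + 3 / 2 * (a₁ + a₂) * y ^ 2 + 3 * a₁ * a₂ * y

section Momentum

variable {a₁ a₂ : ℝ}

theorem contDiff_momentumCubic {n : ℕ∞ω} : ContDiff ℝ n (momentumCubic a₁ a₂) := by
  unfold momentumCubic
  fun_prop

/-- This factorisation is what singles out the cubic: its factors are the base weights of the
metric, and its reciprocal gives the fibre weight. -/
theorem hasDerivAt_momentumCubic (y : ℝ) :
    HasDerivAt (momentumCubic a₁ a₂) (3 * (y + a₁) * (y + a₂)) y := by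
  have h := (((hasDerivAt_id y).pow 3).add (((hasDerivAt_id y).pow 2).const_mul
    (3 / 2 * (a₁ + a₂)))).add ((hasDerivAt_id y).const_mul (3 * a₁ * a₂))
  refine h.congr_deriv ?_
  simp
  ring

theorem strictMonoOn_momentumCubic {m : ℝ} (h₁ : m < a₁) (h₂ : m < a₂) :
    StrictMonoOn (momentumCubic a₁ a₂) (Set.Ici (-m)) := by
  refine strictMonoOn_of_deriv_pos (convex_Ici _)
    (contDiff_momentumCubic (n := 0)).continuous.continuousOn fun y hy => ?_
  rw [interior_Ici, Set.mem_Ioi] at hy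
  rw [(hasDerivAt_momentumCubic y).deriv]
  have : 0 < y + a₁ := by linarith
  have : 0 < y + a₂ := by linarith
  positivity

/-- The cubic `momentumCubic`, continued linearly to the left of `-m`. -/
noncomputable def momentumExt (m a₁ a₂ y : ℝ) : ℝ :=
  momentumCubic a₁ a₂ (max y (-m)) + min (y + m) 0

theorem momentumExt_of_le {m y : ℝ} (h : -m ≤ y) :
    momentumExt m a₁ a₂ y = momentumCubic a₁ a₂ y := by
  rw [momentumExt, max_eq_left h, min_eq_right (by linarith), add_zero]

theorem continuous_momentumExt (m : ℝ) : Continuous (momentumExt m a₁ a₂) :=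
  ((contDiff_momentumCubic (n := 0)).continuous.comp (by fun_prop)).add (by fun_prop)

theorem strictMono_momentumExt {m : ℝ} (h₁ : m < a₁) (h₂ : m < a₂) :
    StrictMono (momentumExt m a₁ a₂) := by
  intro x y hxy
  rcases lt_or_ge (-m) y with h | h
  · refine add_lt_add_of_lt_of_le ?_ (min_le_min_right _ (by linarith))
    refine strictMonoOn_momentumCubic h₁ h₂ (Set.mem_Ici.2 (le_max_right _ _))
      (Set.mem_Ici.2 (le_max_right _ _)) ?_
    rw [max_eq_left h.le]
    exact max_lt hxy h
  · rw [momentumExt, momentumExt, max_eq_right h, max_eq_right (hxy.le.trans h),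
      min_eq_left (by linarith), min_eq_left (by linarith)]
    linarith

theorem surjective_momentumExt {m : ℝ} (hm : 0 < m) (h₁ : m < a₁) (h₂ : m < a₂) :
    Function.Surjective (momentumExt m a₁ a₂) := by
  have ha₁ : 0 < a₁ := hm.trans h₁
  have ha₂ : 0 < a₂ := hm.trans h₂
  refine (continuous_momentumExt m).surjective ?_ ?_
  · refine Filter.tendsto_atTop_mono' _ ?_
      (Filter.tendsto_id.const_mul_atTop (by positivity : 0 < 3 * a₁ * a₂))
    filter_upwards [Filter.eventually_ge_atTop 0] with y hy
    rw [momentumExt_of_le (by linarith), momentumCubic, id]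
    have : 0 ≤ y ^ 3 + 3 / 2 * (a₁ + a₂) * y ^ 2 := by positivity
    linarith
  · refine (Filter.tendsto_atBot_add_const_left _ (momentumCubic a₁ a₂ (-m) + m)
      Filter.tendsto_id).congr' ?_
    filter_upwards [Filter.eventually_le_atBot (-m)] with y hy
    rw [momentumExt, max_eq_right hy, min_eq_left (by linarith), id]
    ring

/-- A continuous inverse of the cubic that is smooth near `[0, ∞)`. -/
theorem exists_momentum (ha₁ : 0 < a₁) (ha₂ : 0 < a₂) :
    ∃ Y : ℝ → ℝ, Continuous Y ∧ ∀ U, 0 ≤ U → 0 ≤ Y U ∧ momentumCubic a₁ a₂ (Y U) = U ∧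
      ContDiffAt ℝ ∞ Y U ∧ HasDerivAt Y (3 * (Y U + a₁) * (Y U + a₂))⁻¹ U := by
  -- With 0 < m < min(a₁, a₂) the cubic is still increasing on `[-m, ∞)`, so y = 0 is interior to
  -- the region where the extension agrees with it, and the inverse is smooth at U = 0.
  obtain ⟨m, hm, hm'⟩ := exists_between (lt_min ha₁ ha₂)
  obtain ⟨h₁, h₂⟩ := lt_min_iff.1 hm'
  have hmono := strictMono_momentumExt h₁ h₂
  let e : ℝ ≃ₜ ℝ :=
    (hmono.orderIsoOfSurjective _ (surjective_momentumExt hm h₁ h₂)).toHomeomorph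
  have he : ∀ y, e y = momentumExt m a₁ a₂ y := fun _ => rfl
  refine ⟨e.symm, e.symm.continuous, fun U hU => ?_⟩
  have hY : 0 ≤ e.symm U := by
    rw [← hmono.le_iff_le, ← he, ← he, e.apply_symm_apply, he, momentumExt_of_le (by linarith)]
    simpa [momentumCubic] using hU
  have hQ : momentumExt m a₁ a₂ =ᶠ[𝓝 (e.symm U)] momentumCubic a₁ a₂ := by
    filter_upwards [lt_mem_nhds (show -m < e.symm U by linarith)] with y hy
    exact momentumExt_of_le hy.le
  have hd : HasDerivAt e (3 * (e.symm U + a₁) * (e.symm U + a₂)) (e.symm U) :=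
    (hasDerivAt_momentumCubic _).congr_of_eventuallyEq hQ
  have hne : 3 * (e.symm U + a₁) * (e.symm U + a₂) ≠ 0 := by positivity
  refine ⟨hY, ?_, ?_, ?_⟩
  · rw [← hQ.eq_of_nhds, ← he, e.apply_symm_apply]
  · exact e.toOpenPartialHomeomorph.contDiffAt_symm_deriv hne (Set.mem_univ _) hd
      (contDiff_momentumCubic.contDiffAt.congr_of_eventuallyEq hQ)
  · exact hd.of_local_left_inverse e.symm.continuous.continuousAt hne
      (Filter.Eventually.of_forall e.apply_symm_apply)

/-- A primitive gains one order of differentiability; apply this at every finite order. -/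
theorem contDiffAt_of_hasDerivAt {f f' : ℝ → ℝ} (h : ∀ x, HasDerivAt f (f' x) x) {x : ℝ}
    (h' : ContDiffAt ℝ ∞ f' x) : ContDiffAt ℝ ∞ f x := by
  rw [contDiffAt_infty]
  intro n
  refine ContDiffAt.of_le (n := (n : ℕ∞ω) + 1) ?_ le_self_add
  rw [contDiffAt_succ_iff_hasFDerivAt]
  refine ⟨fun x => ContinuousLinearMap.toSpanSingleton ℝ (f' x),
    ⟨Set.univ, Filter.univ_mem, fun x _ => (h x).hasFDerivAt⟩, ?_⟩
  exact (ContinuousLinearMap.contDiff (ContinuousLinearMap.toSpanSingletonCLE (𝕜 := ℝ) (E := ℝ) :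
    ℝ →L[ℝ] ℝ →L[ℝ] ℝ)).contDiffAt.comp x
    (contDiffAt_infty.1 h' n)

/-- `Φ` is the Kähler potential as a function of `U = u²`: it is smooth near `[0, ∞)` and satisfies
`2 U Φ'(U) = Y(U)`, where `Y(U)` is the nonnegative root of the cubic at the value `U`. -/
def IsMomentumPotential (a₁ a₂ : ℝ) (Y Φ : ℝ → ℝ) : Prop :=
  ∀ U, 0 ≤ U → 0 ≤ Y U ∧ momentumCubic a₁ a₂ (Y U) = U ∧
    HasDerivAt Y (3 * (Y U + a₁) * (Y U + a₂))⁻¹ U ∧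
    ContDiffAt ℝ ∞ Φ U ∧ 2 * U * deriv Φ U = Y U

theorem exists_isMomentumPotential (ha₁ : 0 < a₁) (ha₂ : 0 < a₂) :
    ∃ Y Φ : ℝ → ℝ, IsMomentumPotential a₁ a₂ Y Φ := by
  obtain ⟨Y, hYc, hY⟩ := exists_momentum ha₁ ha₂
  let D : ℝ → ℝ := fun y => y ^ 2 + 3 / 2 * (a₁ + a₂) * y + 3 * a₁ * a₂
  -- The intended Φ' is 1 / (2 D(Y)). The cutoff makes it continuous on all of ℝ and is inactive
  -- near `[0, ∞)`, where D(Y) > a₁a₂.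
  let H : ℝ → ℝ := fun U => (2 * max (D (Y U)) (a₁ * a₂))⁻¹
  have hHc : Continuous H := by
    refine Continuous.inv₀ (by fun_prop) fun U => ?_
    have : 0 < max (D (Y U)) (a₁ * a₂) := lt_max_of_lt_right (by positivity)
    positivity
  have hΦ : ∀ U, HasDerivAt (fun U => ∫ s in (0 : ℝ)..U, H s) (H U) U := fun U =>
    intervalIntegral.integral_hasDerivAt_right (hHc.intervalIntegrable _ _)
      (hHc.stronglyMeasurableAtFilter _ _) hHc.continuousAt
  have hD : ∀ U, 0 ≤ U → a₁ * a₂ < D (Y U) := fun U hU => by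
    have := (hY U hU).1
    have h : 0 < Y U ^ 2 + 3 / 2 * (a₁ + a₂) * Y U + 2 * (a₁ * a₂) := by positivity
    simp only [D]
    linarith
  refine ⟨Y, fun U => ∫ s in (0 : ℝ)..U, H s, fun U hU => ?_⟩
  obtain ⟨h1, h2, h3, h4⟩ := hY U hU
  refine ⟨h1, h2, h4, contDiffAt_of_hasDerivAt hΦ ?_, ?_⟩
  · have hH : H =ᶠ[𝓝 U] fun U => (2 * D (Y U))⁻¹ := by
      have hc : ContinuousAt (fun U => D (Y U)) U := by fun_prop
      filter_upwards [hc.eventually (lt_mem_nhds (hD U hU))] with x hx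
      simp only [H, max_eq_left hx.le]
    refine ContDiffAt.congr_of_eventuallyEq (ContDiffAt.inv ?_ ?_) hH
    · fun_prop
    · have := (by positivity : 0 < a₁ * a₂).trans (hD U hU)
      positivity
  · have hpos := (by positivity : 0 < a₁ * a₂).trans (hD U hU)
    rw [(hΦ U).deriv]
    simp only [H, max_eq_left (hD U hU).le]
    have h5 : Y U * D (Y U) = momentumCubic a₁ a₂ (Y U) := by simp only [D, momentumCubic]; ring
    rw [h2] at h5
    field_simp
    linarith

theorem IsMomentumPotential.add_const {Y Φ : ℝ → ℝ} (h : IsMomentumPotential a₁ a₂ Y Φ) (C : ℝ) :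
    IsMomentumPotential a₁ a₂ Y (fun U => Φ U + C) := fun U hU => by
  obtain ⟨h1, h2, h3, h4, h5⟩ := h U hU
  exact ⟨h1, h2, h3, h4.add contDiffAt_const, by rwa [deriv_add_const]⟩

/-- At `U = 0` this is obtained from one-sided derivatives. -/
theorem IsMomentumPotential.deriv_add_mul_deriv {Y Φ : ℝ → ℝ} (h : IsMomentumPotential a₁ a₂ Y Φ)
    {U : ℝ} (hU : 0 ≤ U) :
    deriv Φ U + U * deriv (deriv Φ) U = (6 * (Y U + a₁) * (Y U + a₂))⁻¹ := by
  obtain ⟨-, -, h3, h4, -⟩ := h U hU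
  have hd : DifferentiableAt ℝ (deriv Φ) U := by
    have h4' : ContDiffAt ℝ 2 Φ U := h4.of_le ENat.LEInfty.out
    have := (h4'.fderiv_right (m := 1) (by norm_num)).differentiableAt one_ne_zero
    exact this.clm_apply (differentiableAt_const _)
  -- Differentiate Y = 2 U Φ', known only on `[0, ∞)`, and compare with the inverse-function
  -- derivative of Y.
  have h6 : HasDerivWithinAt Y _ (Set.Ici 0) U :=
    (((hasDerivAt_id U).const_mul 2).mul hd.hasDerivAt).hasDerivWithinAt.congr
      (fun x hx => (h x hx).2.2.2.2.symm) (h U hU).2.2.2.2.symm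
  have h7 := (uniqueDiffOn_Ici (0 : ℝ) U hU).eq_deriv _ h6 h3.hasDerivWithinAt
  simp only [id, mul_one] at h7
  have h8 : (6 * (Y U + a₁) * (Y U + a₂))⁻¹ = (3 * (Y U + a₁) * (Y U + a₂))⁻¹ / 2 := by
    rw [show 6 * (Y U + a₁) * (Y U + a₂) = 3 * (Y U + a₁) * (Y U + a₂) * 2 by ring, mul_inv]
    rfl
  rw [h8]
  linarith

theorem eq_of_momentumCubic_eq (ha₁ : 0 < a₁) (ha₂ : 0 < a₂) {x y : ℝ} (hx : 0 ≤ x) (hy : 0 ≤ y)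
    (h : momentumCubic a₁ a₂ x = momentumCubic a₁ a₂ y) : x = y :=
  (strictMonoOn_momentumCubic ha₁ ha₂).injOn (by simpa using hx) (by simpa using hy) h

theorem IsMomentumPotential.isCalabiProfile {Y Φ : ℝ → ℝ} (h : IsMomentumPotential a₁ a₂ Y Φ) :
    IsCalabiProfile a₁ a₂ (fun u => Y (u ^ 2)) (fun u => Φ (u ^ 2)) := by
  intro u hu
  obtain ⟨h1, h2, -, h4, h5⟩ := h (u ^ 2) (sq_nonneg u)
  refine ⟨⟨h1.lt_of_ne fun h0 => ?_, ?_⟩, ?_⟩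
  · rw [← h0] at h2
    simp only [momentumCubic, ne_eq, OfNat.ofNat_ne_zero, not_false_eq_true, zero_pow, mul_zero,
      add_zero] at h2
    exact hu.ne' (pow_eq_zero_iff two_ne_zero |>.1 h2.symm)
  · rw [momentumCubic] at h2
    linarith
  · have h6 := HasDerivAt.comp (h := fun u : ℝ => u ^ 2) u
      (h4.differentiableAt (by simp)).hasDerivAt (hasDerivAt_pow 2 u)
    refine h6.congr_deriv ?_
    simp only [← h5]
    field_simp
    norm_num
    ring

/-- The cubic is injective on `[0, ∞)`, so the positive root, and with it the derivative of the
profile, is unique. -/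
theorem IsCalabiProfile.exists_eq_add (ha₁ : 0 < a₁) (ha₂ : 0 < a₂) {y φ Y Φ : ℝ → ℝ}
    (h : IsCalabiProfile a₁ a₂ y φ)
    (h' : IsCalabiProfile a₁ a₂ Y Φ) : ∃ C, ∀ u, 0 < u → φ u = Φ u + C := by
  have hy : ∀ u, 0 < u → y u = Y u := fun u hu => by
    obtain ⟨⟨h1, h2⟩, -⟩ := h u hu
    obtain ⟨⟨h3, h4⟩, -⟩ := h' u hu
    refine eq_of_momentumCubic_eq ha₁ ha₂ h1.le h3.le ?_
    simp only [momentumCubic]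
    linarith
  have hd : ∀ u, 0 < u → HasDerivAt (fun u => φ u - Φ u) 0 u := fun u hu => by
    have := (h u hu).2.sub (h' u hu).2
    rwa [hy u hu, sub_self] at this
  obtain ⟨C, hC⟩ := isOpen_Ioi.exists_is_const_of_deriv_eq_zero isPreconnected_Ioi
    (fun u hu => (hd u hu).differentiableAt.differentiableWithinAt) (fun u hu => (hd u hu).deriv)
  exact ⟨C, fun u hu => by linarith [hC u hu]⟩

end Momentum

/-! ## The Kähler form in a standard chart -/

/-- The Hermitian form with `ℂ`-coframe `dz₁`, `dz₂`, `dv + t₁ dz₁ + t₂ dz₂` and weights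
`d₁`, `d₂`, `κ`. -/
noncomputable def coframeForm (d₁ d₂ κ : ℝ) (t₁ t₂ : ℂ) (v w : C3) : ℂ :=
  d₁ * (v 0 * star (w 0)) + d₂ * (v 1 * star (w 1)) +
    κ * ((v 2 + t₁ * v 0 + t₂ * v 1) * star (w 2 + t₁ * w 0 + t₂ * w 1))

theorem coframeForm_mulI (d₁ d₂ κ : ℝ) (t₁ t₂ : ℂ) (v w : C3) :
    coframeForm d₁ d₂ κ t₁ t₂ v (mulI w) = -Complex.I * coframeForm d₁ d₂ κ t₁ t₂ v w := by
  simp [coframeForm, mulI_apply]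
  ring

theorem coframeForm_self_pos {d₁ d₂ κ : ℝ} (h₁ : 0 < d₁) (h₂ : 0 < d₂) (hκ : 0 < κ) (t₁ t₂ : ℂ)
    {v : C3} (hv : v ≠ 0) : 0 < (coframeForm d₁ d₂ κ t₁ t₂ v v).re := by
  have h : (coframeForm d₁ d₂ κ t₁ t₂ v v).re = d₁ * Complex.normSq (v 0) +
      d₂ * Complex.normSq (v 1) + κ * Complex.normSq (v 2 + t₁ * v 0 + t₂ * v 1) := by
    simp only [coframeForm, Complex.star_def, Complex.mul_conj, ← Complex.ofReal_mul,
      ← Complex.ofReal_add, Complex.ofReal_re]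
  rw [h]
  have n₀ := Complex.normSq_nonneg (v 0)
  have n₁ := Complex.normSq_nonneg (v 1)
  have n₂ := Complex.normSq_nonneg (v 2 + t₁ * v 0 + t₂ * v 1)
  by_cases h0 : v 0 = 0
  · by_cases h1 : v 1 = 0
    · have h2 : v 2 ≠ 0 := fun h2 => hv (by ext a; fin_cases a <;> simpa)
      have := Complex.normSq_pos.2 h2
      simp only [h0, h1, mul_zero, add_zero, map_zero, zero_add]
      positivity
    · have := Complex.normSq_pos.2 h1
      positivity
  · have := Complex.normSq_pos.2 h0
    positivity

/-- The coframe is a unipotent change of the coordinate one, so the determinant is the product of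
the weights. -/
theorem det_coframeForm (d₁ d₂ κ : ℝ) (t₁ t₂ : ℂ) :
    (Matrix.of fun a b : Fin 3 =>
      coframeForm d₁ d₂ κ t₁ t₂ (Pi.single a 1) (Pi.single b 1)).det =
      ((d₁ * d₂ * κ : ℝ) : ℂ) := by
  rw [Matrix.det_fin_three]
  simp [coframeForm, Pi.single_apply]
  ring

theorem HasLevi.coeffMatrix_eq {f : C3 → ℝ} {c : C3} {α : C3 → ℂ} {β : C3 → C3 → ℂ}
    (h : HasLevi f c α β) (hβ : ∀ v w, β v (mulI w) = -Complex.I * β v w) :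
    coeffMatrix (iddbar f c) = Matrix.of fun a b => β (Pi.single a 1) (Pi.single b 1) := by
  ext a b
  rw [coeffMatrix, h.iddbar_eq, h.iddbar_eq_neg, hβ, Matrix.of_apply]
  apply Complex.ext <;> simp

theorem HasLevi.congr {f : C3 → ℝ} {c : C3} {α α' : C3 → ℂ} {β β' : C3 → C3 → ℂ}
    (h : HasLevi f c α β) (h1 : ∀ v, α v = α' v) (h2 : ∀ v w, β v w = β' v w) :
    HasLevi f c α' β' := by
  obtain rfl : α = α' := funext h1
  obtain rfl : β = β' := funext fun v => funext (h2 v)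
  exact h

/-- The Hermitian factor `1 + |z_b|²`. -/
noncomputable def fsWeight (b : Fin 3) (c : C3) : ℝ := 1 + ‖c b‖ ^ 2

theorem fsWeight_pos (b : Fin 3) (c : C3) : 0 < fsWeight b c := by
  unfold fsWeight
  positivity

theorem ofReal_norm_sq (z : ℂ) : ((‖z‖ ^ 2 : ℝ) : ℂ) = z * star z := by
  rw [Complex.star_def, Complex.mul_conj, Complex.normSq_eq_norm_sq]

theorem ofReal_fsWeight (b : Fin 3) (c : C3) : (fsWeight b c : ℂ) = 1 + c b * star (c b) := by
  rw [fsWeight, Complex.ofReal_add, Complex.ofReal_one, ofReal_norm_sq]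

theorem hasLevi_fsWeight (b : Fin 3) (c : C3) :
    HasLevi (fsWeight b) c (fun v => star (c b) * v b) (fun v w => v b * star (w b)) :=
  ((HasLevi.const 1 c).add (HasLevi.normSq_apply b c)).congr (by simp) (by simp)

theorem hasLevi_log {f : C3 → ℝ} {c : C3} {α : C3 → ℂ} {β : C3 → C3 → ℂ} (h : HasLevi f c α β)
    (h0 : f c ≠ 0) :
    HasLevi (fun x => Real.log (f x)) c (fun v => α v / f c)
      (fun v w => β v w / f c - α v * star (α w) / f c ^ 2) := by
  have hd : deriv (deriv Real.log) (f c) = -(f c ^ 2)⁻¹ := by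
    rw [Real.deriv_log', deriv_inv]
  refine (h.comp (Real.contDiffAt_log.2 h0)).congr (fun v => ?_) fun v w => ?_
  · rw [Real.deriv_log]
    push_cast
    ring
  · rw [hd, Real.deriv_log]
    push_cast
    ring

/-- The Fubini–Study form: the two terms of `hasLevi_log` combine through (1 + |z|²) - |z|² = 1. -/
theorem hasLevi_log_fsWeight (b : Fin 3) (c : C3) :
    HasLevi (fun x => Real.log (fsWeight b x)) c (fun v => star (c b) * v b / fsWeight b c)
      (fun v w => v b * star (w b) / fsWeight b c ^ 2) := by
  refine (hasLevi_log (hasLevi_fsWeight b c) (fsWeight_pos b c).ne').congr (fun v => rfl)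
    fun v w => ?_
  have h : (fsWeight b c : ℂ) ≠ 0 := mod_cast (fsWeight_pos b c).ne'
  field_simp
  rw [ofReal_fsWeight]
  simp only [star_mul', star_star]
  ring

/-- The squared norm `|v|² (1 + |z₁|²)² (1 + |z₂|²)²` on `𝒪(-2,-2)` in a standard chart. -/
noncomputable def normV (c : C3) : ℝ :=
  ‖c 2‖ ^ 2 * ((fsWeight 0 c * fsWeight 1 c) * (fsWeight 0 c * fsWeight 1 c))

theorem normV_nonneg (c : C3) : 0 ≤ normV c := by
  unfold normV
  have := fsWeight_pos 0 c
  have := fsWeight_pos 1 c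
  positivity

/-- For V = |v|² h this is ∂∂̄V = V ∂∂̄ log h + h θ ⊗ θ̄ with θ = dv + v ∂ log h. Unlike ∂V ⊗ ∂̄V /
V, the last term makes sense at v = 0. -/
theorem hasLevi_normV (c : C3) : ∃ α β, HasLevi normV c α β ∧
    (∀ v, α v = star (c 2) * (fsWeight 0 c * fsWeight 1 c) ^ 2 *
      (v 2 + 2 * c 2 * star (c 0) / fsWeight 0 c * v 0 +
        2 * c 2 * star (c 1) / fsWeight 1 c * v 1)) ∧
    ∀ v w, β v w = 2 * normV c *
        (v 0 * star (w 0) / fsWeight 0 c ^ 2 + v 1 * star (w 1) / fsWeight 1 c ^ 2) +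
      (fsWeight 0 c * fsWeight 1 c) ^ 2 *
      ((v 2 + 2 * c 2 * star (c 0) / fsWeight 0 c * v 0 +
        2 * c 2 * star (c 1) / fsWeight 1 c * v 1) *
      star (w 2 + 2 * c 2 * star (c 0) / fsWeight 0 c * w 0 +
        2 * c 2 * star (c 1) / fsWeight 1 c * w 1)) := by
  have hP := (hasLevi_fsWeight 0 c).mul (hasLevi_fsWeight 1 c)
  have h0 : (fsWeight 0 c : ℂ) ≠ 0 := mod_cast (fsWeight_pos 0 c).ne'
  have h1 : (fsWeight 1 c : ℂ) ≠ 0 := mod_cast (fsWeight_pos 1 c).ne'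
  refine ⟨_, _, (HasLevi.normSq_apply 2 c).mul (hP.mul hP), fun v => ?_, fun v w => ?_⟩
  · rw [ofReal_norm_sq]
    push_cast
    field_simp
    ring
  · rw [ofReal_norm_sq]
    have hs : ∀ r : ℝ, star (r : ℂ) = r := fun r => Complex.conj_ofReal r
    simp only [normV, Complex.ofReal_mul, ofReal_norm_sq, star_add, star_mul', star_star, star_div₀,
      hs, star_ofNat]
    field_simp
    simp only [ofReal_fsWeight]
    ring

/-- The local Kähler potential `a₁ log (1 + |z₁|²) + a₂ log (1 + |z₂|²) + Φ(U)`. -/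
noncomputable def calabiPotential (a₁ a₂ : ℝ) (Φ : ℝ → ℝ) (c : C3) : ℝ :=
  a₁ * Real.log (fsWeight 0 c) + a₂ * Real.log (fsWeight 1 c) + Φ (normV c)

theorem contDiff_fsWeight {n : ℕ∞ω} (b : Fin 3) : ContDiff ℝ n (fsWeight b) :=
  contDiff_const.add (ContDiff.norm_sq ℝ (by fun_prop))

theorem contDiff_normV {n : ℕ∞ω} : ContDiff ℝ n normV :=
  (ContDiff.norm_sq ℝ (by fun_prop)).mul (((contDiff_fsWeight 0).mul (contDiff_fsWeight 1)).mul
    ((contDiff_fsWeight 0).mul (contDiff_fsWeight 1)))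

theorem contDiff_log_fsWeight {n : ℕ∞ω} (b : Fin 3) :
    ContDiff ℝ n fun c => Real.log (fsWeight b c) :=
  (contDiff_fsWeight b).log fun c => (fsWeight_pos b c).ne'

section Potential

variable {a₁ a₂ : ℝ} {Y Φ : ℝ → ℝ}

theorem IsMomentumPotential.contDiff_comp_normV (h : IsMomentumPotential a₁ a₂ Y Φ) :
    ContDiff ℝ ∞ fun c => Φ (normV c) :=
  contDiff_iff_contDiffAt.2 fun c =>
    (h _ (normV_nonneg c)).2.2.2.1.comp c contDiff_normV.contDiffAt

theorem IsMomentumPotential.contDiff_calabiPotential (h : IsMomentumPotential a₁ a₂ Y Φ) :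
    ContDiff ℝ ∞ (calabiPotential a₁ a₂ Φ) :=
  ((contDiff_const.mul (contDiff_log_fsWeight 0)).add
    (contDiff_const.mul (contDiff_log_fsWeight 1))).add h.contDiff_comp_normV

theorem IsMomentumPotential.hasLevi_calabiPotential (ha₁ : 0 < a₁) (ha₂ : 0 < a₂)
    (h : IsMomentumPotential a₁ a₂ Y Φ) (c : C3) :
    ∃ (α : C3 → ℂ) (d₁ d₂ κ : ℝ) (t₁ t₂ : ℂ), 0 < d₁ ∧ 0 < d₂ ∧ 0 < κ ∧ d₁ * d₂ * κ = 1 / 6 ∧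
      HasLevi (calabiPotential a₁ a₂ Φ) c α (coframeForm d₁ d₂ κ t₁ t₂) := by
  have hU := normV_nonneg c
  obtain ⟨h1, -, -, h4, h5⟩ := h _ hU
  have h6 := h.deriv_add_mul_deriv hU
  obtain ⟨α, β, hV, hα, hβ⟩ := hasLevi_normV c
  have hΦ : ContDiffAt ℝ 2 Φ (normV c) := h4.of_le ENat.LEInfty.out
  have p0 := fsWeight_pos 0 c
  have p1 := fsWeight_pos 1 c
  have n0 : (fsWeight 0 c : ℂ) ≠ 0 := mod_cast p0.ne'
  have n1 : (fsWeight 1 c : ℂ) ≠ 0 := mod_cast p1.ne'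
  have q1 : 0 < Y (normV c) + a₁ := by positivity
  have q2 : 0 < Y (normV c) + a₂ := by positivity
  have hlog (a : ℝ) (b : Fin 3) := HasLevi.comp (φ := fun x => a * x) (by fun_prop)
    (hasLevi_log_fsWeight b c)
  refine ⟨_, (Y (normV c) + a₁) / fsWeight 0 c ^ 2, (Y (normV c) + a₂) / fsWeight 1 c ^ 2,
    (fsWeight 0 c * fsWeight 1 c) ^ 2 * (6 * (Y (normV c) + a₁) * (Y (normV c) + a₂))⁻¹,
    2 * c 2 * star (c 0) / fsWeight 0 c, 2 * c 2 * star (c 1) / fsWeight 1 c,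
    by positivity, by positivity, by positivity, by field_simp,
    (((hlog a₁ 0).add (hlog a₂ 1)).add (HasLevi.comp hΦ hV)).congr (fun _ => rfl) fun v w => ?_⟩
  have hd : ∀ a : ℝ, deriv (fun x => a * x) = fun _ => a := fun a => by
    ext x
    simp
  have hs : ∀ r : ℝ, star (r : ℂ) = r := fun r => Complex.conj_ofReal r
  -- This turns Φ'' ∂V ⊗ ∂̄V into U Φ'' h θ ⊗ θ̄, which joins Φ' h θ ⊗ θ̄ to give the fibre weight.
  have hc : (fsWeight 0 c * fsWeight 1 c : ℂ) ^ 2 * (c 2 * star (c 2)) = normV c := by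
    rw [normV]
    push_cast
    rw [← Complex.ofReal_pow, ofReal_norm_sq]
    ring
  rw [hα, hα, hβ, coframeForm, ← h6, ← h5]
  simp only [hd, deriv_const]
  generalize deriv (deriv Φ) (normV c) = q
  generalize deriv Φ (normV c) = p
  set A := v 2 + 2 * c 2 * star (c 0) / fsWeight 0 c * v 0 +
    2 * c 2 * star (c 1) / fsWeight 1 c * v 1
  set B := w 2 + 2 * c 2 * star (c 0) / fsWeight 0 c * w 0 +
    2 * c 2 * star (c 1) / fsWeight 1 c * w 1
  simp only [star_mul', star_star, star_pow, hs]
  push_cast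
  rw [← hc]
  field_simp
  ring

theorem IsMomentumPotential.iddbar_pos (ha₁ : 0 < a₁) (ha₂ : 0 < a₂)
    (h : IsMomentumPotential a₁ a₂ Y Φ) (c : C3) {v : C3} (hv : v ≠ 0) :
    0 < iddbar (calabiPotential a₁ a₂ Φ) c ![v, mulI v] := by
  obtain ⟨α, d₁, d₂, κ, t₁, t₂, h₁, h₂, hκ, -, hL⟩ := h.hasLevi_calabiPotential ha₁ ha₂ c
  rw [hL.iddbar_eq]
  have := coframeForm_self_pos h₁ h₂ hκ t₁ t₂ hv
  positivity

theorem IsMomentumPotential.det_coeffMatrix (ha₁ : 0 < a₁) (ha₂ : 0 < a₂)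
    (h : IsMomentumPotential a₁ a₂ Y Φ) (c : C3) :
    (coeffMatrix (iddbar (calabiPotential a₁ a₂ Φ) c)).det = ((1 / 6 : ℝ) : ℂ) := by
  obtain ⟨α, d₁, d₂, κ, t₁, t₂, -, -, -, hd, hL⟩ := h.hasLevi_calabiPotential ha₁ ha₂ c
  rw [hL.coeffMatrix_eq (coframeForm_mulI d₁ d₂ κ t₁ t₂), det_coframeForm, hd]

end Potential

/-! ## Gluing the local forms -/

namespace Tot

variable {k : ℕ}

theorem chart_mem_atlas (k : ℕ) (i j : Fin 2) : chart k i j ∈ atlas C3 (Tot k) :=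
  ⟨(i, j), rfl⟩

/-- Tangent spaces are read in the preferred chart `chartAt`, so an inverse chart differentiates as
a transition map. -/
theorem mfderiv_chart_symm (i j : Fin 2) (c : C3) :
    mfderiv 𝓘(ℝ, C3) 𝓘(ℝ, C3) (chart k i j).symm c =
      fderiv ℝ (fun c' => chartAt C3 (param k i j c) (param k i j c')) c := by
  have h : MDifferentiableAt 𝓘(ℝ, C3) 𝓘(ℝ, C3) (chart k i j).symm c :=
    mdifferentiableAt_atlas_symm (chart_mem_atlas k i j) (Set.mem_univ c)
  refine h.mfderiv.trans ?_
  simp only [modelWithCornersSelf_coe, Set.range_id, fderivWithin_univ]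
  rfl

theorem norm_ins_sq_add (i i' : Fin 2) (z : ℂ) :
    ‖ins i z i'‖ ^ 2 + ‖ins i z (i' + 1)‖ ^ 2 = 1 + ‖z‖ ^ 2 := by
  fin_cases i <;> fin_cases i' <;> simp [ins, add_comm]

/-- The change of coordinates from the chart `(i, j)` to the chart `(i', j')`. -/
noncomputable def transition (k : ℕ) (i j i' j' : Fin 2) (c : C3) : C3 :=
  coordFun k i' j' (param k i j c)

theorem transition_zero (i j i' j' : Fin 2) (c : C3) :
    transition k i j i' j' c 0 = ins i (c 0) (i' + 1) / ins i (c 0) i' := rfl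

theorem transition_one (i j i' j' : Fin 2) (c : C3) :
    transition k i j i' j' c 1 = ins j (c 1) (j' + 1) / ins j (c 1) j' := rfl

theorem transition_two (i j i' j' : Fin 2) (c : C3) :
    transition k i j i' j' c 2 = ins i (c 0) i' ^ k * ins j (c 1) j' ^ k * c 2 := rfl

theorem one_add_norm_div_sq {i i' : Fin 2} {z : ℂ} (h : ins i z i' ≠ 0) :
    1 + ‖ins i z (i' + 1) / ins i z i'‖ ^ 2 = (1 + ‖z‖ ^ 2) / ‖ins i z i'‖ ^ 2 := by
  have : ‖ins i z i'‖ ≠ 0 := norm_ne_zero_iff.2 h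
  rw [← norm_ins_sq_add i i' z, norm_div]
  field_simp

/-- The factors gained by the fibre coordinate cancel those lost by the weights 1 + |z|². -/
theorem normV_transition {i j i' j' : Fin 2} {c : C3} (h0 : ins i (c 0) i' ≠ 0)
    (h1 : ins j (c 1) j' ≠ 0) : normV (transition 2 i j i' j' c) = normV c := by
  have n0 : ‖ins i (c 0) i'‖ ≠ 0 := norm_ne_zero_iff.2 h0
  have n1 : ‖ins j (c 1) j'‖ ≠ 0 := norm_ne_zero_iff.2 h1
  simp only [normV, fsWeight, transition_zero, transition_one, transition_two,
    one_add_norm_div_sq h0, one_add_norm_div_sq h1, norm_mul, norm_pow]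
  field_simp

/-- The entry is either 1 or a nonvanishing coordinate z, and log |z|² is pluriharmonic. -/
theorem iddbar_log_norm_ins {i i' : Fin 2} {b : Fin 3} {c : C3} (h : ins i (c b) i' ≠ 0) :
    ContDiffAt ℝ 2 (fun x : C3 => Real.log (‖ins i (x b) i'‖ ^ 2)) c ∧
      iddbar (fun x => Real.log (‖ins i (x b) i'‖ ^ 2)) c = 0 := by
  rcases eq_or_ne i' i with rfl | hi
  · simp only [ins_same, norm_one, one_pow]
    exact ⟨contDiffAt_const, iddbar_const _ c⟩
  · have hins : ∀ z, ins i z i' = z := fun z => by rw [ins, Function.update_of_ne hi]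
    simp only [hins] at h ⊢
    have hn : ‖c b‖ ^ 2 ≠ 0 := by positivity
    have hL := hasLevi_log (HasLevi.normSq_apply b c) hn
    refine ⟨hL.contDiffAt, ?_⟩
    ext v
    have hv : v = ![v 0, v 1] := by ext a; fin_cases a <;> rfl
    have hn' : ((‖c b‖ ^ 2 : ℝ) : ℂ) ≠ 0 := by exact_mod_cast hn
    have hz : ∀ v w : C3, v b * star (w b) / ((‖c b‖ ^ 2 : ℝ) : ℂ) -
        star (c b) * v b * star (star (c b) * w b) / ((‖c b‖ ^ 2 : ℝ) : ℂ) ^ 2 = 0 := fun v w => by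
      field_simp
      rw [ofReal_norm_sq, star_mul', star_star]
      ring
    rw [hv, hL.iddbar_eq_neg, hz]
    simp

theorem calabiPotential_transition (a₁ a₂ : ℝ) (Φ : ℝ → ℝ) {i j i' j' : Fin 2} {c : C3}
    (h0 : ins i (c 0) i' ≠ 0) (h1 : ins j (c 1) j' ≠ 0) :
    calabiPotential a₁ a₂ Φ c = calabiPotential a₁ a₂ Φ (transition 2 i j i' j' c) +
      (a₁ * Real.log (‖ins i (c 0) i'‖ ^ 2) + a₂ * Real.log (‖ins j (c 1) j'‖ ^ 2)) := by
  have n0 : ‖ins i (c 0) i'‖ ^ 2 ≠ 0 := by positivity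
  have n1 : ‖ins j (c 1) j'‖ ^ 2 ≠ 0 := by positivity
  have p0 : 1 + ‖c 0‖ ^ 2 ≠ 0 := by positivity
  have p1 : 1 + ‖c 1‖ ^ 2 ≠ 0 := by positivity
  simp only [calabiPotential, normV_transition h0 h1, fsWeight, transition_zero, transition_one,
    one_add_norm_div_sq h0, one_add_norm_div_sq h1]
  rw [Real.log_div p0 n0, Real.log_div p1 n1]
  ring

theorem isOpen_preimage_domain (k : ℕ) (i j i' j' : Fin 2) :
    IsOpen {c : C3 | param k i j c ∈ domain k i' j'} := by
  have h : Continuous (param k i j) :=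
    continuousOn_univ.1 (chart k i j).continuousOn_invFun
  exact (isOpen_domain k i' j').preimage h

theorem iddbar_calabiPotential_transition {a₁ a₂ : ℝ} {Y Φ : ℝ → ℝ}
    (h : IsMomentumPotential a₁ a₂ Y Φ) {i j i' j' : Fin 2} {c : C3}
    (hc : param 2 i j c ∈ domain 2 i' j') :
    (iddbar (calabiPotential a₁ a₂ Φ) (transition 2 i j i' j' c)).compContinuousLinearMap
      (fderiv ℝ (transition 2 i j i' j') c) = iddbar (calabiPotential a₁ a₂ Φ) c := by
  have hF : ContDiff ℝ 2 (calabiPotential a₁ a₂ Φ) :=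
    h.contDiff_calabiPotential.of_le ENat.LEInfty.out
  have hnhds := (isOpen_preimage_domain 2 i j i' j').mem_nhds hc
  have hT : ContDiffAt ℂ ω (transition 2 i j i' j') c :=
    (contDiffOn_transition i j i' j').contDiffAt hnhds
  have hcomp : ContDiffAt ℝ 2 (fun x => calabiPotential a₁ a₂ Φ (transition 2 i j i' j' x)) c :=
    hF.contDiffAt.comp c ((hT.restrict_scalars ℝ).of_le le_top)
  obtain ⟨s0, z0⟩ := iddbar_log_norm_ins hc.1
  obtain ⟨s1, z1⟩ := iddbar_log_norm_ins hc.2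
  have heq : calabiPotential a₁ a₂ Φ =ᶠ[𝓝 c] fun c =>
      calabiPotential a₁ a₂ Φ (transition 2 i j i' j' c) +
      (a₁ * Real.log (‖ins i (c 0) i'‖ ^ 2) + a₂ * Real.log (‖ins j (c 1) j'‖ ^ 2)) := by
    filter_upwards [hnhds] with x hx
    exact calabiPotential_transition a₁ a₂ Φ hx.1 hx.2
  rw [← iddbar_comp hF.contDiffAt hT, heq.iddbar_eq,
    iddbar_add hcomp ((contDiffAt_const.mul s0).add (contDiffAt_const.mul s1)),
    iddbar_add (contDiffAt_const.mul s0) (contDiffAt_const.mul s1), iddbar_const_smul,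
    iddbar_const_smul, z0, z1]
  simp

/-- The two-form on `𝒪(-2,-2)` with local potential `calabiPotential`. -/
noncomputable def calabiForm (a₁ a₂ : ℝ) (Φ : ℝ → ℝ) : TwoForm (Tot 2) := fun x =>
  iddbar (calabiPotential a₁ a₂ Φ) (chartAt C3 x x)

section CalabiForm

variable {a₁ a₂ : ℝ} {Y Φ : ℝ → ℝ}

/-- `calabiForm` uses a preferred chart chosen point by point; gluing shows that the choice does not
matter, which yields smoothness and closedness. -/
theorem inChart_calabiForm (h : IsMomentumPotential a₁ a₂ Y Φ) (i j : Fin 2) (c : C3) :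
    (calabiForm a₁ a₂ Φ).inChart (chart 2 i j) c = iddbar (calabiPotential a₁ a₂ Φ) c := by
  rw [TwoForm.inChart, mfderiv_chart_symm]
  exact iddbar_calabiPotential_transition h (exists_mem_domain (param 2 i j c)).choose_spec

theorem isKahler_calabiForm (ha₁ : 0 < a₁) (ha₂ : 0 < a₂) (h : IsMomentumPotential a₁ a₂ Y Φ) :
    (calabiForm a₁ a₂ Φ).IsKahler where
  smooth := by
    rintro _ ⟨⟨i, j⟩, rfl⟩
    rw [funext (inChart_calabiForm h i j)]
    exact h.contDiff_calabiPotential.iddbar.contDiffOn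
  closed := by
    rintro _ ⟨⟨i, j⟩, rfl⟩ c -
    rw [funext (inChart_calabiForm h i j)]
    exact extDeriv_iddbar h.contDiff_calabiPotential c
  typeOneOne x v w := iddbar_mulI_mulI
    (h.contDiff_calabiPotential.of_le ENat.LEInfty.out).contDiffAt v w
  positive x v hv := h.iddbar_pos ha₁ ha₂ _ hv

theorem isRicciFlat_calabiForm (ha₁ : 0 < a₁) (ha₂ : 0 < a₂)
    (h : IsMomentumPotential a₁ a₂ Y Φ) : (calabiForm a₁ a₂ Φ).IsRicciFlat := by
  rintro _ ⟨⟨i, j⟩, rfl⟩ c -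
  rw [TwoForm.ricciForm]
  simp only [inChart_calabiForm h, h.det_coeffMatrix ha₁ ha₂, iddbar_const, neg_zero]

end CalabiForm

/-! ## The double cover -/

/-- The map `(z₁, z₂, w) ↦ (z₁, z₂, w²)`. -/
def sqCoord (c : C3) : C3 := ![c 0, c 1, c 2 ^ 2]

theorem contDiff_sqCoord {𝕜 : Type*} [NontriviallyNormedField 𝕜] [NormedAlgebra 𝕜 ℂ] :
    ContDiff 𝕜 ω sqCoord := by
  refine contDiff_pi.2 fun a => ?_
  fin_cases a
  · exact contDiff_apply 𝕜 ℂ (0 : Fin 3)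
  · exact contDiff_apply 𝕜 ℂ (1 : Fin 3)
  · exact (contDiff_apply 𝕜 ℂ (2 : Fin 3)).pow 2

theorem mdifferentiableAt_sq (i j : Fin 2) (c : C3) :
    MDifferentiableAt 𝓘(ℝ, C3) 𝓘(ℝ, C3) sq (param 1 i j c) := by
  have h1 : MDifferentiableAt 𝓘(ℝ, C3) 𝓘(ℝ, C3) (chart 1 i j) (param 1 i j c) :=
    mdifferentiableAt_atlas (chart_mem_atlas 1 i j) (param_mem_domain i j c)
  have h2 : MDifferentiableAt 𝓘(ℝ, C3) 𝓘(ℝ, C3) sqCoord (chart 1 i j (param 1 i j c)) :=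
    ((contDiff_sqCoord (𝕜 := ℝ)).differentiable (by simp) _).mdifferentiableAt
  have h3 : MDifferentiableAt 𝓘(ℝ, C3) 𝓘(ℝ, C3) (chart 2 i j).symm
      (sqCoord (chart 1 i j (param 1 i j c))) :=
    mdifferentiableAt_atlas_symm (chart_mem_atlas 2 i j) (Set.mem_univ _)
  refine (MDifferentiableAt.comp (param 1 i j c) h3
    (MDifferentiableAt.comp (param 1 i j c) h2 h1)).congr_of_eventuallyEq ?_
  filter_upwards [(isOpen_domain 1 i j).mem_nhds (param_mem_domain i j c)] with x hx
  conv_lhs => rw [← param_coordFun i j x hx]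
  rfl

theorem inChart_pullback_sq (η : TwoForm (Tot 2)) (i j : Fin 2) (c : C3) :
    (TwoForm.pullback sq η).inChart (chart 1 i j) c =
      (η.inChart (chart 2 i j) (sqCoord c)).compContinuousLinearMap (fderiv ℝ sqCoord c) := by
  have h1 : MDifferentiableAt 𝓘(ℝ, C3) 𝓘(ℝ, C3) (chart 1 i j).symm c :=
    mdifferentiableAt_atlas_symm (chart_mem_atlas 1 i j) (Set.mem_univ c)
  have h2 : MDifferentiableAt 𝓘(ℝ, C3) 𝓘(ℝ, C3) sqCoord c :=
    ((contDiff_sqCoord (𝕜 := ℝ)).differentiable (by simp) _).mdifferentiableAt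
  have h3 : MDifferentiableAt 𝓘(ℝ, C3) 𝓘(ℝ, C3) (chart 2 i j).symm (sqCoord c) :=
    mdifferentiableAt_atlas_symm (chart_mem_atlas 2 i j) (Set.mem_univ _)
  have h4 : mfderiv 𝓘(ℝ, C3) 𝓘(ℝ, C3) (sq ∘ (chart 1 i j).symm) c = _ :=
    mfderiv_comp c (mdifferentiableAt_sq i j c) h1
  have h5 := mfderiv_comp c h3 h2
  -- The chain rule applied to both factorisations compares the two derivatives.
  have h6 : sq ∘ (chart 1 i j).symm = (chart 2 i j).symm ∘ sqCoord := rfl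
  rw [h6, h5, mfderiv_eq_fderiv] at h4
  ext v
  change η _ _ = η _ _
  congr 1
  ext1 a
  exact (congrFun (congrArg DFunLike.coe h4) (v a)).symm

/-- Squaring the fibre coordinate turns `normV` into `normU ^ 2`. Away from w = 0 one has u > 0,
where φ is known. -/
theorem isCalabiForm_pullback_sq {a₁ a₂ : ℝ} {Y Φ φ : ℝ → ℝ} (h : IsMomentumPotential a₁ a₂ Y Φ)
    (hφ : ∀ u, 0 < u → φ u = Φ (u ^ 2)) :
    IsCalabiForm a₁ a₂ φ (TwoForm.pullback sq (calabiForm a₁ a₂ Φ)) := by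
  intro i j c hc
  have hF : ContDiff ℝ 2 (calabiPotential a₁ a₂ Φ) :=
    h.contDiff_calabiPotential.of_le ENat.LEInfty.out
  have hS : ContDiff ℝ 2 sqCoord := contDiff_sqCoord.of_le le_top
  have hV : ContDiffAt ℝ 2 (fun x => Φ (normV (sqCoord x))) c :=
    ((h.contDiff_comp_normV.of_le ENat.LEInfty.out).comp hS).contDiffAt
  have hφΦ : (fun x => φ (normU x)) =ᶠ[𝓝 c] fun x => Φ (normV (sqCoord x)) := by
    have : ∀ᶠ x : C3 in 𝓝 c, x 2 ≠ 0 :=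
      (continuous_apply (2 : Fin 3)).continuousAt.eventually_ne hc
    filter_upwards [this] with x hx
    have hu : 0 < normU x := by
      unfold normU
      positivity
    rw [hφ _ hu]
    congr 1
    simp [normU, normV, sqCoord, fsWeight]
    ring
  have s0 : ContDiffAt ℝ 2 (fun x => a₁ * Real.log (fsWeight 0 x)) c :=
    contDiffAt_const.mul (contDiff_log_fsWeight 0).contDiffAt
  have s1 : ContDiffAt ℝ 2 (fun x => a₂ * Real.log (fsWeight 1 x)) c :=
    contDiffAt_const.mul (contDiff_log_fsWeight 1).contDiffAt
  rw [inChart_pullback_sq, inChart_calabiForm h,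
    ← iddbar_comp hF.contDiffAt contDiff_sqCoord.contDiffAt, hφΦ.iddbar_eq]
  change iddbar (fun x => a₁ * Real.log (fsWeight 0 x) + a₂ * Real.log (fsWeight 1 x) +
    Φ (normV (sqCoord x))) c = _
  rw [iddbar_add (s0.add s1) hV, iddbar_add s0 s1, iddbar_const_smul, iddbar_const_smul]
  rfl

end Tot

/-! ### The Ricci-flat Kähler form on 𝒪(-2,-2) -/

theorem mainTheorem12 (a₁ a₂ : ℝ) (ha₁ : 0 < a₁) (ha₂ : 0 < a₂) :
    (∃ y φ : ℝ → ℝ, IsCalabiProfile a₁ a₂ y φ) ∧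
    ∀ y φ : ℝ → ℝ, IsCalabiProfile a₁ a₂ y φ →
      ∃ η : TwoForm (Tot 1), IsCalabiForm a₁ a₂ φ η ∧
        ∃ ηhat : TwoForm (Tot 2),
          (∀ x ∉ Tot.zeroSection 1, TwoForm.pullback Tot.sq ηhat x = η x) ∧
          ηhat.IsKahler ∧ ηhat.IsRicciFlat := by
  obtain ⟨Y, Φ, hΦ⟩ := exists_isMomentumPotential ha₁ ha₂
  refine ⟨⟨_, _, hΦ.isCalabiProfile⟩, fun y φ h => ?_⟩
  obtain ⟨C, hC⟩ := h.exists_eq_add ha₁ ha₂ hΦ.isCalabiProfile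
  have hΦC := hΦ.add_const C
  -- The form on 𝒪(-1,-1) is taken to be the pullback itself; off the zero section the local formula
  -- determines it.
  exact ⟨_, Tot.isCalabiForm_pullback_sq hΦC hC, _, fun _ _ => rfl,
    Tot.isKahler_calabiForm ha₁ ha₂ hΦC, Tot.isRicciFlat_calabiForm ha₁ ha₂ hΦC⟩
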